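/- Let $G$ be a connected graph with shortest-path distance $d$. A set $C$ of vertices is convex if $w\in C$ whenever $u,v\in C$ and $d(u,w)+d(w,v)=d(u,v)$. The convex hull $\mathrm{conv}(X)$ of a set $X$ of vertices is the intersection of all convex sets containing $X$. The graph $G$ has the strong hull property if $|\mathrm{conv}(u,v)|\cdot|\mathrm{conv}(v,w)|\ge|\mathrm{conv}(u,v,w)|$ for all vertices $u,v,w$. For a group $W$ with generating set $S$ of involutions, let $\mathrm{Cay}(W,S)$ be the undirected right Cayley graph, in which $w$ is adjacent to $ws$ for all $w\in W$, $s\in S$. Theorem. Let $n\ge 0$. (1) Let $S_n$ be the symmetric group on $n$ letters, with the adjacent transpositions $(i\ \,i+1)$, $1\le i\le n-1$, as simple reflections. Then the right Cayley graph of $S_n$ is connected and has the strong hull property. (2) Let $B_n$ be the hyperoctahedral group of all permutations $w$ of $\{-n,\dots,-1,1,\dots,n\}$ with $w(-i)=-w(i)$ for all $i$, with simple reflections $(i\ \,i+1)(-i\ \,-(i+1))$ for $1\le i\le n-1$ and, if $n\ge1$, $(1\ \,-1)$. Then the right Cayley graph of $B_n$ is connected and has the strong hull property. (3) (Sidorenko's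 inequality.) Let $P$ be a finite poset with $n$ elements that is 2-dimensional, i.e. its order is the intersection of two linear orders. Then there is a partial order $\overline P$ on the same set which is a complement of $P$, i.e. two distinct elements are comparable in $\overline P$ if and only if they are incomparable in $P$; and every such $\overline P$ satisfies $e(P)\,e(\overline P)\ge n!$, where $e$ denotes the number of linear extensions. -/

import Mathlib

/-! ### Convexity in graphs and the strong hull property -/

/-- A set of vertices is convex if every vertex lying on a shortest path between two of its
members (that is, `d(u,w) + d(w,v) = d(u,v)`) belongs to it. -/
def IsGraphConvex {V : Type*} (G : SimpleGraph V) (C : Set V) : Prop :=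
  ∀ u ∈ C, ∀ v ∈ C, ∀ w, G.dist u w + G.dist w v = G.dist u v → w ∈ C

/-- The convex hull of `X`: the intersection of all convex sets containing `X`. -/
def graphHull {V : Type*} (G : SimpleGraph V) (X : Set V) : Set V :=
  ⋂₀ {C | IsGraphConvex G C ∧ X ⊆ C}

/-- The strong hull property of a connected graph:
`|conv(u,v)| * |conv(v,w)| ≥ |conv(u,v,w)|` for all vertices `u, v, w`. -/
structure HasStrongHullProperty {V : Type*} (G : SimpleGraph V) : Prop where
  connected : G.Connected
  hull_le : ∀ u v w : V,
    (graphHull G {u, v, w}).encard ≤ (graphHull G {u, v}).encard * (graphHull G {v, w}).encard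

/-! ### The symmetric group -/

/-- The simple reflections `(i i+1)` of the symmetric group on `n` letters. -/
def symmSimple (n : ℕ) : Set (Equiv.Perm (Fin n)) :=
  {s | ∃ i j : Fin n, (j : ℕ) = i + 1 ∧ s = Equiv.swap i j}

/-! ### The hyperoctahedral group -/

/-- The set `{-n, …, -1, 1, …, n}`. -/
abbrev SignedIndex (n : ℕ) : Type := {k : ℤ // k ≠ 0 ∧ |k| ≤ n}

instance SignedIndex.instNeg (n : ℕ) : Neg (SignedIndex n) :=
  ⟨fun k => ⟨-k.1, neg_ne_zero.mpr k.2.1, (abs_neg k.1).le.trans k.2.2⟩⟩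

theorem SignedIndex.neg_neg {n : ℕ} (k : SignedIndex n) : - -k = k :=
  Subtype.ext (_root_.neg_neg k.1)

/-- The hyperoctahedral group `B_n`: the permutations `w` of `{-n, …, -1, 1, …, n}` with
`w (-k) = -w k` for all `k`. -/
def hyperoctahedral (n : ℕ) : Subgroup (Equiv.Perm (SignedIndex n)) where
  carrier := {w | ∀ k, w (-k) = -w k}
  one_mem' := fun _ => rfl
  mul_mem' := by
    intro a b ha hb k
    rw [Equiv.Perm.mul_apply, hb k, ha (b k), Equiv.Perm.mul_apply]
  inv_mem' := by
    intro a ha k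
    rw [Equiv.Perm.inv_eq_iff_eq, ha]
    exact congrArg Neg.neg (Equiv.apply_symm_apply a k).symm

/-- The underlying permutation of the reflection `t_{i,j}`: the product `(i j)(-i -j)`, or just
`(i j)` when `j = -i`. -/
def signedSwapPerm {n : ℕ} (i j : SignedIndex n) : Equiv.Perm (SignedIndex n) :=
  if j = -i then Equiv.swap i j else Equiv.swap i j * Equiv.swap (-i) (-j)

theorem signedSwapPerm_mem {n : ℕ} (i j : SignedIndex n) :
    signedSwapPerm i j ∈ hyperoctahedral n := by
  have hself : ∀ a : SignedIndex n, a ≠ -a := fun a h => by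
    have h1 : a.1 = -a.1 := congrArg Subtype.val h
    exact a.2.1 (by omega)
  have key : ∀ (A : Type) [DecidableEq A] (N : A → A), (∀ a, N (N a) = a) → (∀ a, a ≠ N a) →
      ∀ a b k : A, (if b = N a then Equiv.swap a b else Equiv.swap a b * Equiv.swap (N a) (N b)) (N k)
        = N ((if b = N a then Equiv.swap a b else Equiv.swap a b * Equiv.swap (N a) (N b)) k) := by
    intro A _ N hN hne a b k
    split_ifs with h
    · subst h
      simp only [Equiv.swap_apply_def]
      grind
    · simp only [Equiv.Perm.mul_apply, Equiv.swap_apply_def]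
      grind
  exact key (SignedIndex n) (fun a => -a) SignedIndex.neg_neg hself i j

/-- The reflection `t_{i,j}` as an element of the hyperoctahedral group. -/
def signedSwap {n : ℕ} (i j : SignedIndex n) : hyperoctahedral n :=
  ⟨signedSwapPerm i j, signedSwapPerm_mem i j⟩

/-- The simple reflections of `B_n`: `t_{i,i+1}` for `1 ≤ i ≤ n - 1`, and `t_{1,-1}`. -/
def hyperoctahedralSimple (n : ℕ) : Set (hyperoctahedral n) :=
  {s | ∃ i j : SignedIndex n, 1 ≤ i.1 ∧ j.1 = i.1 + 1 ∧ s = signedSwap i j} ∪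
    {s | ∃ i : SignedIndex n, i.1 = 1 ∧ s = signedSwap i (-i)}

/-! ### Linear extensions of finite posets -/

/-- The number `e(P)` of linear extensions: order-preserving bijections onto the chain with
`Fintype.card α` elements. -/
noncomputable def numLinearExtensions {α : Type*} [Fintype α] (P : PartialOrder α) : ℕ :=
  Nat.card {f : α ≃ Fin (Fintype.card α) // ∀ x y, P.le x y → f x ≤ f y}

/-- A poset is 2-dimensional if its order is the intersection of two linear orders
(thus chains are included). -/
def IsTwoDimensional {α : Type*} (P : PartialOrder α) : Prop :=
  ∃ L₁ L₂ : LinearOrder α, ∀ x y, P.le x y ↔ L₁.le x y ∧ L₂.le x y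

/-- `Q` is a complement of `P`: distinct elements are comparable in exactly one of `P`, `Q`. -/
def IsComplementOrder {α : Type*} (P Q : PartialOrder α) : Prop :=
  ∀ x y, x ≠ y → ((Q.le x y ∨ Q.le y x) ↔ ¬ (P.le x y ∨ P.le y x))

/-!
In the Cayley graphs of `S_n` and `B_n`, the distance of two elements counts the pairs of letters
(for `B_n`, the pairs up to sign) that stand in different order in their one-line notations, see
`connected_and_mul_dist_eq`. A hull therefore lies in the set of all elements extending the order
common to its generators, and for two generators it is equal to that set: each such element lies on
a shortest path between the two. With `p` the common order of `u, v`, `q` that of `v, w` and `r`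
that of `u, v, w`, the strong hull property thus becomes an inequality `e(r) ≤ e(p) e(q)` between numbers
of (signed) linear extensions, where `r` is the intersection of `p` and `q`. Since `p` and `q` both
have the linear extension `v`, two elements comparable for `p` and for `q` are comparable for `r`.

The inequality is proved by an injection. `bumpInsert p x` turns a linear extension of the
restriction of `p` to the complement of `x` into one of `p`, by letting `x` travel to the right
through the word and exchanging the carried letter with each larger letter it meets; this reverses
the promotion operator. By `bumpInsert_eq` it is injective for fixed `x`, and letters `x`, `y` whose
insertions have a common value are comparable for `p`. Inserting the letters of a linear extension
of `r` one after the other, from the last to the first, yields a linear extension of `p` and one of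
`q`. These determine the given word: if two words with first letters `x ≠ y` had the same pair of
images, then `x` and `y` would be comparable for both `p` and `q`, hence for `r`, whereas both are
minimal for `r`.

For `B_n` a letter and its negative are inserted from the two ends simultaneously
(`signedInsert`); they are exchanged when they meet in the middle if their order requires it. The
values of this map obey the same rule, `signedInsert_eq`, and the argument goes through unchanged.

Sidorenko's inequality is the case in which `p` and `q` are complementary and `r` is empty.
-/

/-! ### Words compatible with an order, and insertion -/

/-- A word is compatible with the strict order `r` if no letter is `r`-below an earlier one. -/
def IsCompatible {α : Type*} (r : α → α → Prop) (l : List α) : Prop :=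
  l.Pairwise fun a b => ¬ r b a

open Classical in
/-- Insertion of the letter `c` into a word: a carried letter, initially `c`, moves through the
word from left to right; on meeting a larger letter it stays in front of that letter, which is
carried on instead. This undoes the jeu-de-taquin slide of the promotion operator. -/
noncomputable def bumpInsert {α : Type*} (r : α → α → Prop) : α → List α → List α
  | c, [] => [c]
  | c, a :: l => if r c a then c :: bumpInsert r a l else a :: bumpInsert r c l

section BumpInsert

variable {α : Type*} {r : α → α → Prop}

theorem bumpInsert_perm (c : α) (l : List α) : (bumpInsert r c l).Perm (c :: l) := by
  induction l generalizing c with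
  | nil => exact List.Perm.refl _
  | cons a l ih =>
    rw [bumpInsert]
    split_ifs
    · exact (ih a).cons c
    · exact ((ih c).cons a).trans (List.Perm.swap c a l)

theorem mem_bumpInsert {c b : α} {l : List α} : b ∈ bumpInsert r c l ↔ b = c ∨ b ∈ l := by
  rw [(bumpInsert_perm c l).mem_iff, List.mem_cons]

/-- Insertion preserves compatibility, wherever the inserted letter lies in the order. -/
theorem IsCompatible.bumpInsert [IsStrictOrder α r] {l : List α} (hl : IsCompatible r l) (c : α) :
    IsCompatible r (bumpInsert r c l) := by
  induction l generalizing c with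
  | nil => exact List.pairwise_singleton _ _
  | cons a l ih =>
    obtain ⟨ha, hl⟩ := List.pairwise_cons.1 hl
    rw [_root_.bumpInsert]
    split_ifs with hca
    · refine List.pairwise_cons.2 ⟨fun b hb hbc => ?_, ih hl a⟩
      rcases mem_bumpInsert.1 hb with rfl | hb
      · exact asymm hca hbc
      · exact ha b hb (_root_.trans hbc hca)
    · refine List.pairwise_cons.2 ⟨fun b hb hba => ?_, ih hl c⟩
      rcases mem_bumpInsert.1 hb with rfl | hb
      · exact hca hba
      · exact ha b hb hba

/-- The letters whose insertion can produce a given word form a chain, and each of them determines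
the word it was inserted into. -/
theorem bumpInsert_eq [IsStrictOrder α r] {l l' : List α} (hl : IsCompatible r l)
    (hl' : IsCompatible r l') {x y : α} (h : bumpInsert r x l = bumpInsert r y l') :
    (x = y ∧ l = l') ∨ r x y ∨ r y x := by
  induction l generalizing l' x y with
  | nil =>
    have hlen := (bumpInsert_perm (r := r) y l').length_eq
    rw [← h] at hlen
    obtain rfl : l' = [] := List.length_eq_zero_iff.1 (by simpa [bumpInsert] using hlen.symm)
    exact .inl ⟨by simpa [bumpInsert] using h, rfl⟩
  | cons a m ih =>
    cases l' with
    | nil =>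
      have hlen := (bumpInsert_perm (r := r) x (a :: m)).length_eq
      rw [h] at hlen
      simp [bumpInsert] at hlen
    | cons a' m' =>
      obtain ⟨ha, hm⟩ := List.pairwise_cons.1 hl
      obtain ⟨ha', hm'⟩ := List.pairwise_cons.1 hl'
      rw [bumpInsert, bumpInsert] at h
      split_ifs at h with h1 h2 h2 <;> obtain ⟨hx, h⟩ := List.cons.inj h
      · -- Each carried letter occurs in the other word, hence is not below the other one.
        have hmem : a ∈ bumpInsert r a' m' := h ▸ mem_bumpInsert.2 (.inl rfl)
        have hmem' : a' ∈ bumpInsert r a m := h ▸ mem_bumpInsert.2 (.inl rfl)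
        rcases ih hm hm' h with ⟨h3, h4⟩ | h3 | h3
        · exact .inl ⟨hx, by rw [h3, h4]⟩
        · rcases mem_bumpInsert.1 hmem with rfl | hmem
          · exact absurd h3 (irrefl _)
          · exact absurd h3 (ha' a hmem)
        · rcases mem_bumpInsert.1 hmem' with rfl | hmem'
          · exact absurd h3 (irrefl _)
          · exact absurd h3 (ha a' hmem')
      · have hmem : y ∈ bumpInsert r a m := h ▸ mem_bumpInsert.2 (.inl rfl)
        rcases ih hm hm' h with ⟨rfl, -⟩ | h3 | h3
        · exact .inr (.inl h1)
        · exact .inr (.inl (_root_.trans h1 h3))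
        · rcases mem_bumpInsert.1 hmem with rfl | hmem
          · exact absurd h3 (irrefl _)
          · exact absurd h3 (ha y hmem)
      · have hmem : x ∈ bumpInsert r a' m' := h ▸ mem_bumpInsert.2 (.inl rfl)
        rcases ih hm hm' h with ⟨rfl, -⟩ | h3 | h3
        · exact .inr (.inr h2)
        · rcases mem_bumpInsert.1 hmem with rfl | hmem
          · exact absurd h3 (irrefl _)
          · exact absurd h3 (ha' x hmem)
        · exact .inr (.inr (_root_.trans h2 h3))
      · rcases ih hm hm' h with ⟨h3, h4⟩ | h3
        · exact .inl ⟨h3, by rw [hx, h4]⟩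
        · exact .inr h3

/-- The letter `c` carried out at the end of an insertion is either the inserted letter, nothing
having been bumped, or a larger letter of the word. -/
theorem bumpInsert_eq_concat [IsStrictOrder α r] {x c : α} {l m : List α}
    (h : bumpInsert r x l = m ++ [c]) : (c = x ∧ m = l) ∨ (r x c ∧ c ∈ l) := by
  induction l generalizing x m with
  | nil =>
    rw [bumpInsert, ← List.nil_append [x]] at h
    obtain ⟨h1, h2⟩ := List.append_inj' h rfl
    exact .inl ⟨by simpa using h2.symm, h1.symm⟩
  | cons a l ih =>
    have key : ∀ d e : α, d :: bumpInsert r e l = m ++ [c] →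
        ∃ m', m = d :: m' ∧ bumpInsert r e l = m' ++ [c] := by
      intro d e h
      cases m with
      | nil =>
        have hlen := (bumpInsert_perm (r := r) e l).length_eq
        rw [(List.cons.inj h).2] at hlen
        simp at hlen
      | cons d' m' =>
        rw [List.cons_append] at h
        obtain ⟨rfl, h2⟩ := List.cons.inj h
        exact ⟨m', rfl, h2⟩
    rw [bumpInsert] at h
    split_ifs at h with hxa <;> obtain ⟨m', rfl, h2⟩ := key _ _ h <;>
      rcases ih h2 with ⟨h1, h2⟩ | ⟨h1, h2⟩
    · exact .inr ⟨h1 ▸ hxa, by simp [h1]⟩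
    · exact .inr ⟨_root_.trans hxa h1, List.mem_cons_of_mem _ h2⟩
    · exact .inl ⟨h1, by rw [h2]⟩
    · exact .inr ⟨h1, List.mem_cons_of_mem _ h2⟩

theorem foldr_bumpInsert_perm (l : List α) : (l.foldr (bumpInsert r) []).Perm l := by
  induction l with
  | nil => exact List.Perm.refl _
  | cons x l ih => exact (bumpInsert_perm x _).trans (ih.cons x)

theorem isCompatible_foldr_bumpInsert [IsStrictOrder α r] (l : List α) :
    IsCompatible r (l.foldr (bumpInsert r) []) := by
  induction l with
  | nil => exact List.Pairwise.nil
  | cons x l ih => exact ih.bumpInsert x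

/-- A word compatible with `r` is determined by its two insertion words for `p` and `q`. If the
first letters of two such words differ, then they are comparable both for `p` and for `q`, hence
for `r`, although each of them is `r`-minimal. -/
theorem foldr_bumpInsert_injective {p q : α → α → Prop} [IsStrictOrder α p] [IsStrictOrder α q]
    (hpq : ∀ x y, p x y ∨ p y x → q x y ∨ q y x → r x y ∨ r y x) {l l' : List α}
    (hl : IsCompatible r l) (hl' : IsCompatible r l') (hperm : l.Perm l')
    (hp : l.foldr (bumpInsert p) [] = l'.foldr (bumpInsert p) [])
    (hq : l.foldr (bumpInsert q) [] = l'.foldr (bumpInsert q) []) : l = l' := by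
  induction l generalizing l' with
  | nil => exact hperm.nil_eq
  | cons x l ih =>
    cases l' with
    | nil => exact hperm.eq_nil
    | cons y l' =>
      obtain ⟨hx, hm⟩ := List.pairwise_cons.1 hl
      obtain ⟨hy, hm'⟩ := List.pairwise_cons.1 hl'
      rw [List.foldr_cons, List.foldr_cons] at hp hq
      by_cases hxy : x = y
      · subst hxy
        have tail : ∀ s : α → α → Prop, IsStrictOrder α s →
            bumpInsert s x (l.foldr (bumpInsert s) []) =
              bumpInsert s x (l'.foldr (bumpInsert s) []) →
            l.foldr (bumpInsert s) [] = l'.foldr (bumpInsert s) [] := by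
          intro s _ h
          rcases bumpInsert_eq (isCompatible_foldr_bumpInsert l)
            (isCompatible_foldr_bumpInsert l') h with h | h | h
          · exact h.2
          · exact absurd h (irrefl x)
          · exact absurd h (irrefl x)
        rw [ih hm hm' hperm.cons_inv (tail p ‹_› hp) (tail q ‹_› hq)]
      · have hx' : x ∈ l' := by
          simpa [hxy] using hperm.subset (List.mem_cons_self (a := x) (l := l))
        have hy' : y ∈ l := by
          simpa [Ne.symm hxy] using hperm.symm.subset (List.mem_cons_self (a := y) (l := l'))
        have comparable : ∀ s : α → α → Prop, IsStrictOrder α s →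
            bumpInsert s x (l.foldr (bumpInsert s) []) =
              bumpInsert s y (l'.foldr (bumpInsert s) []) → s x y ∨ s y x := by
          intro s _ h
          exact (bumpInsert_eq (isCompatible_foldr_bumpInsert l)
            (isCompatible_foldr_bumpInsert l') h).resolve_left fun h => hxy h.1
        rcases hpq x y (comparable p ‹_› hp) (comparable q ‹_› hq) with h | h
        · exact absurd h (hy x hx')
        · exact absurd h (hx y hy')

end BumpInsert

/-- The words compatible with `r` in which every letter of `α` occurs exactly once: the linear
extensions of `r`. -/
def linearExtensionWords {α : Type*} (r : α → α → Prop) : Set (List α) :=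
  {l | (l.Nodup ∧ ∀ a, a ∈ l) ∧ IsCompatible r l}

/-- The number of linear extensions is submultiplicative: if any two elements comparable both for
`p` and for `q` are comparable for `r`, then `e(r) ≤ e(p) e(q)`. -/
theorem encard_linearExtensionWords_le {α : Type*} {p q r : α → α → Prop} [IsStrictOrder α p]
    [IsStrictOrder α q] (hpq : ∀ x y, p x y ∨ p y x → q x y ∨ q y x → r x y ∨ r y x) :
    (linearExtensionWords r).encard ≤
      (linearExtensionWords p).encard * (linearExtensionWords q).encard := by
  rw [← Set.encard_prod]
  refine Set.encard_le_encard_of_injOn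
    (f := fun l => (l.foldr (bumpInsert p) [], l.foldr (bumpInsert q) [])) ?_ ?_
  · rintro l ⟨⟨hl, hmem⟩, -⟩
    exact ⟨⟨⟨(foldr_bumpInsert_perm l).nodup_iff.2 hl,
      fun a => (foldr_bumpInsert_perm l).mem_iff.2 (hmem a)⟩, isCompatible_foldr_bumpInsert l⟩,
      ⟨⟨(foldr_bumpInsert_perm l).nodup_iff.2 hl,
      fun a => (foldr_bumpInsert_perm l).mem_iff.2 (hmem a)⟩, isCompatible_foldr_bumpInsert l⟩⟩
  · rintro l ⟨⟨hl, hmem⟩, hr⟩ l' ⟨⟨hl', hmem'⟩, hr'⟩ h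
    exact foldr_bumpInsert_injective hpq hr hr'
      ((List.perm_ext_iff_of_nodup hl hl').2 fun a => iff_of_true (hmem a) (hmem' a))
      (congrArg Prod.fst h) (congrArg Prod.snd h)

/-! ### Signed words and signed insertion -/

section SignedInsert

variable {α : Type*}

/-- The mirror image of a word under an involution `N`, read as negation of letters. A signed
permutation is the word `l ++ mirror N l`, and is encoded by its left half `l`. -/
def mirror (N : α → α) (l : List α) : List α := (l.map N).reverse

/-- The word `l ++ mirror N l` is compatible with `r`, expressed through `l` alone. -/
def IsSignedCompatible (N : α → α) (r : α → α → Prop) (l : List α) : Prop :=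
  IsCompatible r l ∧ ∀ a ∈ l, ∀ b ∈ l, ¬ r (N b) a

open Classical in
/-- Insertion of `x` on the left and, simultaneously, of `N x` on the right of the word
`l ++ mirror N l`. The letter carried from the left through `l` meets its own negative in the
middle, is exchanged with it if it is smaller, and continues through the mirror image of the word
it has left behind. -/
noncomputable def signedInsert (N : α → α) (r : α → α → Prop) (x : α) (l : List α) : List α :=
  match (bumpInsert r x l).reverse with
  | [] => []
  | c :: t => mirror N (bumpInsert r (if r c (N c) then N c else c) (t.map N))

variable {N : α → α} {r : α → α → Prop}

theorem mirror_mirror (hN : ∀ a, N (N a) = a) (l : List α) : mirror N (mirror N l) = l := by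
  simp [mirror, List.map_reverse, Function.comp_def, hN]

theorem mem_mirror (hN : ∀ a, N (N a) = a) {a : α} {l : List α} : a ∈ mirror N l ↔ N a ∈ l := by
  rw [mirror, List.mem_reverse, List.mem_map]
  exact ⟨by rintro ⟨b, hb, rfl⟩; rwa [hN], fun h => ⟨N a, h, hN a⟩⟩

theorem IsCompatible.mirror (hN : ∀ a, N (N a) = a) (hr : ∀ a b, r a b → r (N b) (N a))
    {l : List α} (hl : IsCompatible r l) : IsCompatible r (mirror N l) := by
  rw [_root_.mirror, IsCompatible, List.pairwise_reverse, List.pairwise_map]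
  refine hl.imp fun {a b} hab h => hab ?_
  simpa [hN] using hr _ _ h

theorem cons_append_mirror_perm (x : α) (u : List α) :
    ((x :: u) ++ mirror N (x :: u)).Perm (x :: N x :: (u ++ mirror N u)) := by
  rw [mirror, List.map_cons, List.reverse_cons, List.cons_append, ← List.append_assoc]
  exact (List.perm_append_singleton _ _).cons x

theorem mirror_perm {u v : List α} (h : u.Perm v) : (mirror N u).Perm (mirror N v) :=
  (List.reverse_perm _).trans ((h.map N).trans (List.reverse_perm _).symm)

open Classical in
/-- Signed insertion in terms of the part `m` of the word left behind by the carried letter, the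
letter `c` carried to the middle, and the letter `c'` carried on from there. -/
theorem exists_signedInsert_eq (N : α → α) (r : α → α → Prop) (x : α) (l : List α) :
    ∃ m c c', bumpInsert r x l = m ++ [c] ∧ c' = (if r c (N c) then N c else c) ∧
      signedInsert N r x l = mirror N (bumpInsert r c' (mirror N m)) := by
  rcases h : (bumpInsert r x l).reverse with _ | ⟨c, t⟩
  · have := (bumpInsert_perm (r := r) x l).length_eq
    simp [List.reverse_eq_nil_iff.1 h] at this
  · refine ⟨t.reverse, c, _, ?_, rfl, ?_⟩
    · rw [← List.reverse_reverse (bumpInsert r x l), h, List.reverse_cons]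
    · rw [signedInsert, h]
      simp [mirror, List.map_reverse]

/-- The letters of `signedInsert N r x l` are those of `x :: l` up to sign. -/
theorem signedInsert_perm (hN : ∀ a, N (N a) = a) (x : α) (l : List α) :
    (signedInsert N r x l ++ mirror N (signedInsert N r x l)).Perm
      ((x :: l) ++ mirror N (x :: l)) := by
  obtain ⟨m, c, c', h, hc, h'⟩ := exists_signedInsert_eq N r x l
  have h1 : (c :: m).Perm (x :: l) :=
    (List.perm_append_singleton c m).symm.trans (h ▸ bumpInsert_perm x l)
  have h2 : (mirror N (bumpInsert r c' (mirror N m))).Perm (N c' :: m) := by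
    refine (mirror_perm (bumpInsert_perm (r := r) c' (mirror N m))).trans ?_
    rw [mirror, List.map_cons, List.reverse_cons, ← mirror, mirror_mirror hN]
    exact List.perm_append_singleton _ _
  have h3 : (N c' :: N (N c') :: (m ++ mirror N m)).Perm (c :: N c :: (m ++ mirror N m)) := by
    rw [hc, hN]
    split_ifs
    · rw [hN]
    · exact List.Perm.swap _ _ _
  rw [h']
  exact (h2.append (mirror_perm h2)).trans ((cons_append_mirror_perm _ _).trans
    (h3.trans ((cons_append_mirror_perm _ _).symm.trans (h1.append (mirror_perm h1)))))

section Carried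

variable [IsStrictOrder α r] {x c c' : α} {l m : List α}

/-- The part of the word left behind by the carried letter is again compatible. -/
theorem isSignedCompatible_of_bumpInsert_eq (hN : ∀ a, N (N a) = a)
    (hr : ∀ a b, r a b → r (N b) (N a))
    (hl : IsSignedCompatible N r l)
    (h : bumpInsert r x l = m ++ [c]) : IsSignedCompatible N r m := by
  have hmc : IsCompatible r (m ++ [c]) := h ▸ hl.1.bumpInsert x
  refine ⟨(List.pairwise_append.1 hmc).1, ?_⟩
  rcases bumpInsert_eq_concat h with ⟨-, rfl⟩ | ⟨hxc, hc⟩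
  · exact hl.2
  · have hmem : ∀ q ∈ m, q = x ∨ q ∈ l := fun q hq =>
      mem_bumpInsert.1 (h ▸ List.mem_append_left [c] hq)
    have hx : ∀ q ∈ l, ¬ r (N x) q := fun q hq hxq =>
      hl.2 q hq c hc (_root_.trans (hr _ _ hxc) hxq)
    intro a ha b hb hba
    rcases hmem a ha with rfl | ha <;> rcases hmem b hb with rfl | hb
    · exact hx c hc (_root_.trans hba hxc)
    · exact hx b hb (by simpa [hN] using hr _ _ hba)
    · exact hx a ha hba
    · exact hl.2 a ha b hb hba

open Classical in
theorem not_rel_neg_of_eq_ite (hN : ∀ a, N (N a) = a)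
    (hc' : c' = if r c (N c) then N c else c) : ¬ r c' (N c') := by
  rw [hc']
  split_ifs with h
  · rw [hN]
    exact asymm h
  · exact h

open Classical in
theorem not_rel_of_bumpInsert_eq (hl : IsSignedCompatible N r l)
    (h : bumpInsert r x l = m ++ [c]) (hc' : c' = if r c (N c) then N c else c) :
    ∀ q ∈ m, ¬ r c' q := by
  have hmc : IsCompatible r (m ++ [c]) := h ▸ hl.1.bumpInsert x
  have hcq : ∀ q ∈ m, ¬ r c q := fun q hq =>
    (List.pairwise_append.1 hmc).2.2 q hq c (List.mem_singleton_self c)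
  intro q hq hq'
  rw [hc'] at hq'
  split_ifs at hq' with hcc
  · exact hcq q hq (_root_.trans hcc hq')
  · exact hcq q hq hq'

open Classical in
/-- Once a letter has been bumped, in the left half or in the middle, the carried letter lies above
no letter of the right half. -/
theorem eq_or_rel_of_bumpInsert_eq (hN : ∀ a, N (N a) = a) (hr : ∀ a b, r a b → r (N b) (N a))
    (hl : IsSignedCompatible N r l)
    (h : bumpInsert r x l = m ++ [c]) (hc' : c' = if r c (N c) then N c else c) :
    c' = x ∨ r x c' ∧ ∀ q ∈ m, ¬ r (N q) c' := by
  have hmc : IsCompatible r (m ++ [c]) := h ▸ hl.1.bumpInsert x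
  have hcq : ∀ q ∈ m, ¬ r c q := fun q hq =>
    (List.pairwise_append.1 hmc).2.2 q hq c (List.mem_singleton_self c)
  split_ifs at hc' with hcc
  · refine .inr ⟨?_, fun q hq hqc => hcq q hq ?_⟩
    · rcases bumpInsert_eq_concat h with ⟨rfl, -⟩ | ⟨hxc, -⟩
      · rwa [hc']
      · rw [hc']
        exact _root_.trans hxc hcc
    · rw [hc'] at hqc
      simpa [hN] using hr _ _ hqc
  · rw [hc']
    rcases bumpInsert_eq_concat h with ⟨rfl, -⟩ | ⟨hxc, hcl⟩
    · exact .inl rfl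
    · refine .inr ⟨hxc, fun q hq hqc => ?_⟩
      rcases mem_bumpInsert.1 (h ▸ List.mem_append_left [c] hq) with rfl | hql
      · exact hl.2 c hcl c hcl (_root_.trans (hr _ _ hxc) hqc)
      · exact hl.2 c hcl q hql hqc

theorem IsSignedCompatible.signedInsert (hN : ∀ a, N (N a) = a) (hr : ∀ a b, r a b → r (N b) (N a))
    (hl : IsSignedCompatible N r l) (x : α) :
    IsSignedCompatible N r (signedInsert N r x l) := by
  obtain ⟨m, c, c', h, hc', h'⟩ := exists_signedInsert_eq N r x l
  have hm := isSignedCompatible_of_bumpInsert_eq hN hr hl h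
  rw [h']
  refine ⟨(hm.1.mirror hN hr).bumpInsert c' |>.mirror hN hr, ?_⟩
  have hcq := not_rel_of_bumpInsert_eq hl h hc'
  have hmem : ∀ a ∈ mirror N (bumpInsert r c' (mirror N m)), a = N c' ∨ a ∈ m := by
    intro a ha
    rw [mem_mirror hN, mem_bumpInsert, mem_mirror hN, hN] at ha
    exact ha.imp_left fun h => by rw [← h, hN]
  intro a ha b hb hba
  rcases hmem a ha with rfl | ha <;> rcases hmem b hb with rfl | hb
  · rw [hN] at hba
    exact not_rel_neg_of_eq_ite hN hc' hba
  · exact hcq b hb (by simpa [hN] using hr _ _ hba)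
  · rw [hN] at hba
    exact hcq a ha hba
  · exact hm.2 a ha b hb hba

/-- The letters whose signed insertion can produce a given word form a chain, and each of them
determines the word it was inserted into. -/
theorem signedInsert_eq (hN : ∀ a, N (N a) = a) (hr : ∀ a b, r a b → r (N b) (N a))
    {y : α} {l' : List α} (hl : IsSignedCompatible N r l)
    (hl' : IsSignedCompatible N r l') (h : signedInsert N r x l = signedInsert N r y l') :
    (x = y ∧ l = l') ∨ r x y ∨ r y x := by
  obtain ⟨m, c, d, hb, hd, h1⟩ := exists_signedInsert_eq N r x l
  obtain ⟨m', c', d', hb', hd', h1'⟩ := exists_signedInsert_eq N r y l'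
  have hm := isSignedCompatible_of_bumpInsert_eq hN hr hl hb
  have hm' := isSignedCompatible_of_bumpInsert_eq hN hr hl' hb'
  have hins : bumpInsert r d (mirror N m) = bumpInsert r d' (mirror N m') := by
    rw [← mirror_mirror hN (bumpInsert r d _), ← h1, h, h1', mirror_mirror hN]
  -- Letters carried past the middle that differ are comparable; the lower one then stands in the
  -- right half traversed by the other, which therefore has bumped nothing.
  have differ : ∀ {x y d d' : α} {m l' m' : List α} {c' : α}, IsSignedCompatible N r l' →
      bumpInsert r y l' = m' ++ [c'] →
      (d' = y ∨ r y d' ∧ ∀ q ∈ m', ¬ r (N q) d') → (d = x ∨ r x d) →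
      bumpInsert r d (mirror N m) = bumpInsert r d' (mirror N m') → r d d' → r x y := by
    intro x y d d' m l' m' c' hl' hb' hd' hd hins hdd
    rcases hd' with rfl | ⟨-, hd'⟩
    · rcases hd with rfl | hd
      · exact hdd
      · exact _root_.trans hd hdd
    · have hmem : d ∈ bumpInsert r d' (mirror N m') := hins ▸ mem_bumpInsert.2 (.inl rfl)
      rcases mem_bumpInsert.1 hmem with rfl | hmem
      · exact absurd hdd (irrefl _)
      · exact absurd (by rwa [hN]) (hd' (N d) ((mem_mirror hN).1 hmem))
  have hxd := eq_or_rel_of_bumpInsert_eq hN hr hl hb hd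
  have hyd := eq_or_rel_of_bumpInsert_eq hN hr hl' hb' hd'
  rcases bumpInsert_eq (hm.1.mirror hN hr) (hm'.1.mirror hN hr) hins with ⟨hdd, hmm⟩ | hdd | hdd
  · have hmm : m = m' := by rw [← mirror_mirror hN m, hmm, mirror_mirror hN]
    -- If exactly one of the two insertions exchanges the carried letter with its negative, then
    -- the other one has bumped nothing.
    have exchange : ∀ {x y c c' : α} {l l' m m' : List α}, IsSignedCompatible N r l' →
        bumpInsert r x l = m ++ [c] → bumpInsert r y l' = m' ++ [c'] → r c (N c) → N c = c' →
        r x y := by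
      intro x y c c' l l' m m' hl' hb hb' hcc hc'
      have hxc : r x c' := by
        rcases bumpInsert_eq_concat hb with ⟨rfl, -⟩ | ⟨hxc, -⟩
        · rwa [← hc']
        · rw [← hc']
          exact _root_.trans hxc hcc
      rcases bumpInsert_eq_concat hb' with ⟨rfl, -⟩ | ⟨-, hcl⟩
      · exact hxc
      · refine absurd ?_ (hl'.2 c' hcl c' hcl)
        rwa [← hc', hN]
    by_cases hcc : r c (N c) <;> by_cases hcc' : r c' (N c')
    · rw [if_pos hcc] at hd
      rw [if_pos hcc'] at hd'
      have : c = c' := by rw [← hN c, ← hd, hdd, hd', hN]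
      exact bumpInsert_eq hl.1 hl'.1 (by rw [hb, hb', this, hmm])
    · rw [if_pos hcc] at hd
      rw [if_neg hcc'] at hd'
      exact .inr (.inl (exchange hl' hb hb' hcc (by rw [← hd, hdd, hd'])))
    · rw [if_neg hcc] at hd
      rw [if_pos hcc'] at hd'
      exact .inr (.inr (exchange hl hb' hb hcc' (by rw [← hd', ← hdd, hd])))
    · rw [if_neg hcc] at hd
      rw [if_neg hcc'] at hd'
      exact bumpInsert_eq hl.1 hl'.1 (by rw [hb, hb', ← hd, ← hd', hdd, hmm])
  · exact .inr (.inl (differ hl' hb' hyd (hxd.imp_right And.left) hins hdd))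
  · exact .inr (.inr (differ hl hb hxd (hyd.imp_right And.left) hins.symm hdd))

theorem isSignedCompatible_foldr_signedInsert (hN : ∀ a, N (N a) = a)
    (hr : ∀ a b, r a b → r (N b) (N a)) (l : List α) :
    IsSignedCompatible N r (l.foldr (signedInsert N r) []) := by
  induction l with
  | nil => exact ⟨List.Pairwise.nil, by simp⟩
  | cons x l ih => exact IsSignedCompatible.signedInsert hN hr ih x

end Carried

theorem foldr_signedInsert_perm (hN : ∀ a, N (N a) = a) (l : List α) :
    (l.foldr (signedInsert N r) [] ++ mirror N (l.foldr (signedInsert N r) [])).Perm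
      (l ++ mirror N l) := by
  induction l with
  | nil => exact List.Perm.refl _
  | cons x l ih =>
    refine (signedInsert_perm hN x _).trans ?_
    exact (cons_append_mirror_perm x _).trans
      (((ih.cons _).cons _).trans (cons_append_mirror_perm x l).symm)

/-- A signed word compatible with `r` is determined by its two insertion words for `p` and `q`, for
the same reason as in `foldr_bumpInsert_injective`. -/
theorem foldr_signedInsert_injective {p q : α → α → Prop} [IsStrictOrder α p] [IsStrictOrder α q]
    (hN : ∀ a, N (N a) = a) (hp : ∀ a b, p a b → p (N b) (N a))
    (hq : ∀ a b, q a b → q (N b) (N a))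
    (hpq : ∀ x y, p x y ∨ p y x → q x y ∨ q y x → r x y ∨ r y x) {l l' : List α}
    (hl : IsSignedCompatible N r l) (hl' : IsSignedCompatible N r l')
    (hperm : (l ++ mirror N l).Perm (l' ++ mirror N l'))
    (hlp : l.foldr (signedInsert N p) [] = l'.foldr (signedInsert N p) [])
    (hlq : l.foldr (signedInsert N q) [] = l'.foldr (signedInsert N q) []) : l = l' := by
  induction l generalizing l' with
  | nil => exact (List.append_eq_nil_iff.1 hperm.nil_eq.symm).1.symm
  | cons x l ih =>
    cases l' with
    | nil => exact absurd hperm.eq_nil (by simp)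
    | cons y l' =>
      -- The first letter of a compatible signed word is minimal among all signed letters.
      have minimal : ∀ {y : α} {l : List α}, IsSignedCompatible N r (y :: l) →
          ∀ z ∈ (y :: l) ++ mirror N (y :: l), z ≠ y → ¬ r z y := by
        intro y l hl z hz hzy
        rcases List.mem_append.1 hz with hz | hz
        · exact (List.pairwise_cons.1 hl.1).1 z ((List.mem_cons.1 hz).resolve_left hzy)
        · have := hl.2 y List.mem_cons_self _ ((mem_mirror hN).1 hz)
          rwa [hN] at this
      have tail : ∀ {y : α} {l : List α}, IsSignedCompatible N r (y :: l) →
          IsSignedCompatible N r l := fun h =>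
        ⟨(List.pairwise_cons.1 h.1).2, fun a ha b hb =>
          h.2 a (List.mem_cons_of_mem _ ha) b (List.mem_cons_of_mem _ hb)⟩
      have compare : ∀ s : α → α → Prop, IsStrictOrder α s → (∀ a b, s a b → s (N b) (N a)) →
          (x :: l).foldr (signedInsert N s) [] = (y :: l').foldr (signedInsert N s) [] →
          (x = y ∧ l.foldr (signedInsert N s) [] = l'.foldr (signedInsert N s) []) ∨
            s x y ∨ s y x := by
        intro s _ hs h
        exact signedInsert_eq hN hs (isSignedCompatible_foldr_signedInsert hN hs l)
          (isSignedCompatible_foldr_signedInsert hN hs l') h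
      by_cases hxy : x = y
      · subst hxy
        have hperm' : (l ++ mirror N l).Perm (l' ++ mirror N l') :=
          ((cons_append_mirror_perm x l).symm.trans
            (hperm.trans (cons_append_mirror_perm x l'))).cons_inv.cons_inv
        have h1 := ((compare p ‹_› hp hlp).resolve_right (not_or.2 ⟨irrefl x, irrefl x⟩)).2
        have h2 := ((compare q ‹_› hq hlq).resolve_right (not_or.2 ⟨irrefl x, irrefl x⟩)).2
        rw [ih (tail hl) (tail hl') hperm' h1 h2]
      · rcases hpq x y ((compare p ‹_› hp hlp).resolve_left fun h => hxy h.1)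
          ((compare q ‹_› hq hlq).resolve_left fun h => hxy h.1) with h | h
        · exact absurd h (minimal hl' x (hperm.subset (by simp)) hxy)
        · exact absurd h (minimal hl y (hperm.symm.subset (by simp)) (Ne.symm hxy))

/-- The signed words compatible with `r`, given by their left halves, in which every letter occurs
exactly once. -/
def signedExtensionWords (N : α → α) (r : α → α → Prop) : Set (List α) :=
  {l | ((l ++ mirror N l).Nodup ∧ ∀ a, a ∈ l ++ mirror N l) ∧ IsSignedCompatible N r l}

/-- The signed analogue of `encard_linearExtensionWords_le`, for relations reversed by negation. -/
theorem encard_signedExtensionWords_le {p q : α → α → Prop} [IsStrictOrder α p]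
    [IsStrictOrder α q] (hN : ∀ a, N (N a) = a) (hp : ∀ a b, p a b → p (N b) (N a))
    (hq : ∀ a b, q a b → q (N b) (N a))
    (hpq : ∀ x y, p x y ∨ p y x → q x y ∨ q y x → r x y ∨ r y x) :
    (signedExtensionWords N r).encard ≤
      (signedExtensionWords N p).encard * (signedExtensionWords N q).encard := by
  rw [← Set.encard_prod]
  have words : ∀ s : α → α → Prop, IsStrictOrder α s → (∀ a b, s a b → s (N b) (N a)) →
      ∀ l ∈ signedExtensionWords N r,
        l.foldr (signedInsert N s) [] ∈ signedExtensionWords N s := by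
    rintro s _ hs l ⟨⟨hl, hmem⟩, -⟩
    exact ⟨⟨(foldr_signedInsert_perm hN l).nodup_iff.2 hl,
      fun a => (foldr_signedInsert_perm hN l).mem_iff.2 (hmem a)⟩,
      isSignedCompatible_foldr_signedInsert hN hs l⟩
  refine Set.encard_le_encard_of_injOn
    (f := fun l => (l.foldr (signedInsert N p) [], l.foldr (signedInsert N q) []))
    (fun l hl => ⟨words p ‹_› hp l hl, words q ‹_› hq l hl⟩) ?_
  rintro l ⟨⟨hl, hmem⟩, hc⟩ l' ⟨⟨hl', hmem'⟩, hc'⟩ h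
  exact foldr_signedInsert_injective hN hp hq hpq hc hc'
    ((List.perm_ext_iff_of_nodup hl hl').2 fun a => iff_of_true (hmem a) (hmem' a))
    (congrArg Prod.fst h) (congrArg Prod.snd h)

end SignedInsert

/-! ### Distances and hulls in graphs whose metric counts separating half-spaces -/

section HalfSpaces

open scoped symmDiff

variable {ι : Type*} [DecidableEq ι]

theorem sum_symmDiff_le (wt : ι → ℕ) (s t u : Finset ι) :
    ∑ i ∈ s ∆ u, wt i ≤ ∑ i ∈ s ∆ t, wt i + ∑ i ∈ t ∆ u, wt i := by
  rw [← Finset.sum_union_inter]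
  exact (Finset.sum_le_sum_of_subset (symmDiff_triangle s t u)).trans (Nat.le_add_right _ _)

variable {V : Type*} {G : SimpleGraph V} {H : V → Finset ι} {wt : ι → ℕ} {k : ℕ}

/-- If each edge crosses hyperplanes of total weight `k`, and any vertex has a neighbour closer by
`k` to a given other vertex, then the graph is connected and its metric, multiplied by `k`, is the
total weight of the hyperplanes separating two vertices. Here `H u` is the set of hyperplanes
having `u` on their positive side. -/
theorem connected_and_mul_dist_eq [Nonempty V] (hk : 0 < k)
    (hadj : ∀ u v, G.Adj u v → ∑ i ∈ H u ∆ H v, wt i ≤ k)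
    (hstep : ∀ u v, u ≠ v → ∃ u', G.Adj u u' ∧
      ∑ i ∈ H u' ∆ H v, wt i + k ≤ ∑ i ∈ H u ∆ H v, wt i) :
    G.Connected ∧ ∀ u v, k * G.dist u v = ∑ i ∈ H u ∆ H v, wt i := by
  have hle : ∀ {u v} (p : G.Walk u v), ∑ i ∈ H u ∆ H v, wt i ≤ k * p.length := by
    intro u v p
    induction p with
    | nil => simp
    | @cons u v w h p ih =>
      rw [SimpleGraph.Walk.length_cons, Nat.mul_succ, Nat.add_comm]
      exact (sum_symmDiff_le wt _ (H v) _).trans (Nat.add_le_add (hadj _ _ h) ih)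
  have hwalk : ∀ (m : ℕ) (u v : V), ∑ i ∈ H u ∆ H v, wt i ≤ m →
      ∃ p : G.Walk u v, k * p.length ≤ m := by
    intro m
    induction m using Nat.strong_induction_on with
    | _ m ih =>
      intro u v huv
      by_cases h : u = v
      · subst h
        exact ⟨.nil, by simp⟩
      · obtain ⟨u', hu, hlt⟩ := hstep u v h
        obtain ⟨p, hp⟩ := ih (m - k) (by omega) u' v (by omega)
        refine ⟨.cons hu p, ?_⟩
        rw [SimpleGraph.Walk.length_cons, Nat.mul_succ]
        omega
  have hconn : G.Connected :=
    { preconnected := fun u v => ⟨(hwalk _ u v le_rfl).choose⟩ }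
  refine ⟨hconn, fun u v => le_antisymm ?_ ?_⟩
  · obtain ⟨p, hp⟩ := hwalk _ u v le_rfl
    exact (Nat.mul_le_mul_left k (SimpleGraph.dist_le p)).trans hp
  · obtain ⟨p, hp⟩ := hconn.exists_walk_length_eq_dist u v
    exact hp ▸ hle p

theorem isGraphConvex_halfSpace (hwt : ∀ i, 0 < wt i)
    (hdist : ∀ u v, k * G.dist u v = ∑ i ∈ H u ∆ H v, wt i) (i : ι) :
    IsGraphConvex G {x | i ∈ H x} := by
  intro u hu v hv w hw
  by_contra hiw
  have hiw : i ∉ H w := hiw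
  have hi1 : i ∈ H u ∆ H w := Finset.mem_symmDiff.2 (.inl ⟨hu, hiw⟩)
  have hi2 : i ∈ H w ∆ H v := Finset.mem_symmDiff.2 (.inr ⟨hv, hiw⟩)
  have hsub : H u ∆ H v ⊆ (H u ∆ H w).erase i ∪ (H w ∆ H v).erase i := by
    intro j hj
    have hij : j ≠ i := by
      rintro rfl
      rcases Finset.mem_symmDiff.1 hj with h | h
      · exact h.2 hv
      · exact h.2 hu
    rw [← Finset.erase_union_distrib]
    exact Finset.mem_erase.2 ⟨hij, symmDiff_triangle _ (H w) _ hj⟩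
  have h1 : ∑ j ∈ H u ∆ H v, wt j ≤
      ∑ j ∈ (H u ∆ H w).erase i, wt j + ∑ j ∈ (H w ∆ H v).erase i, wt j := by
    rw [← Finset.sum_union_inter]
    exact (Finset.sum_le_sum_of_subset hsub).trans (Nat.le_add_right _ _)
  have h2 := Finset.add_sum_erase _ wt hi1
  have h3 := Finset.add_sum_erase _ wt hi2
  have h4 := hwt i
  rw [← hdist] at h1 h2 h3
  rw [← hw, Nat.mul_add] at h1
  omega

/-- A hull lies in every half-space containing its generators. -/
theorem graphHull_subset_halfSpaces (hwt : ∀ i, 0 < wt i)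
    (hdist : ∀ u v, k * G.dist u v = ∑ i ∈ H u ∆ H v, wt i) (X : Set V) :
    graphHull G X ⊆ {x | ∀ i, (∀ u ∈ X, i ∈ H u) → i ∈ H x} := fun _ hx i hi =>
  hx {x | i ∈ H x} ⟨isGraphConvex_halfSpace hwt hdist i, hi⟩

/-- The hull of two vertices contains every vertex lying in all the half-spaces that contain both:
such a vertex lies on a shortest path between them. -/
theorem halfSpaces_subset_graphHull_pair (hk : 0 < k)
    (hdist : ∀ u v, k * G.dist u v = ∑ i ∈ H u ∆ H v, wt i) {opp : ι → ι}
    (hopp : ∀ x y i, i ∈ H x → i ∉ H y → opp i ∈ H y ∧ opp i ∉ H x) (u v : V) :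
    {x | ∀ i, i ∈ H u → i ∈ H v → i ∈ H x} ⊆ graphHull G {u, v} := by
  rintro x hx C ⟨hC, huv⟩
  refine hC u (huv (by simp)) v (huv (by simp)) x (Nat.eq_of_mul_eq_mul_left hk ?_)
  have hx' : ∀ i ∈ H x, i ∈ H u ∨ i ∈ H v := by
    intro i hi
    by_contra! h
    have hu := hopp x u i hi h.1
    exact hu.2 (hx _ hu.1 (hopp x v i hi h.2).1)
  rw [Nat.mul_add, hdist, hdist, hdist, ← Finset.sum_union]
  · refine Finset.sum_congr ?_ fun _ _ => rfl
    ext i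
    have := hx i
    have := hx' i
    simp only [Finset.mem_union, Finset.mem_symmDiff]
    tauto
  · rw [Finset.disjoint_left]
    intro i
    have := hx i
    have := hx' i
    simp only [Finset.mem_symmDiff]
    tauto

end HalfSpaces

/-! ### Cayley graphs of groups of permutations of a chain -/

section Cayley

open scoped symmDiff

variable {α : Type*} [Fintype α] [LinearOrder α]

/-- The pairs of letters `(a, b)` such that `a` stands before `b` in the one-line notation of `w`.
-/
def orderedPairs (w : Equiv.Perm α) : Finset (α × α) :=
  Finset.univ.filter fun p => w⁻¹ p.1 < w⁻¹ p.2

/-- The ordered pairs of elements whose relative order is reversed by `w⁻¹`. -/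
def reversedPairs (w : Equiv.Perm α) : Finset (α × α) :=
  Finset.univ.filter fun p => ¬ (w⁻¹ p.1 < w⁻¹ p.2 ↔ p.1 < p.2)

theorem mem_orderedPairs {w : Equiv.Perm α} {p : α × α} :
    p ∈ orderedPairs w ↔ w⁻¹ p.1 < w⁻¹ p.2 := by
  simp [orderedPairs]

theorem mem_reversedPairs {w : Equiv.Perm α} {p : α × α} :
    p ∈ reversedPairs w ↔ ¬ (w⁻¹ p.1 < w⁻¹ p.2 ↔ p.1 < p.2) := by
  simp [reversedPairs]

theorem orderedPairs_symmDiff (u v : Equiv.Perm α) :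
    orderedPairs u ∆ orderedPairs v =
      (reversedPairs (u⁻¹ * v)).map (Equiv.prodCongr u u).toEmbedding := by
  ext ⟨a, b⟩
  rw [Finset.mem_map_equiv, mem_reversedPairs, Finset.mem_symmDiff, mem_orderedPairs,
    mem_orderedPairs]
  have h : (Equiv.prodCongr u u).symm (a, b) = (u⁻¹ a, u⁻¹ b) := rfl
  have hu : ∀ c, u (u⁻¹ c) = c := u.apply_symm_apply
  simp only [h, mul_inv_rev, inv_inv, Equiv.Perm.mul_apply, hu]
  tauto

/-- A permutation of a finite chain other than the identity has a descent. -/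
theorem exists_covBy_apply_lt {w : Equiv.Perm α} (hw : w ≠ 1) : ∃ i j, i ⋖ j ∧ w j < w i := by
  classical
  let _ : LocallyFiniteOrder α := Fintype.toLocallyFiniteOrder
  by_contra! h
  have hmono : StrictMono w := (strictMono_iff_forall_covBy w).2 fun a b hab =>
    (h a b hab).lt_of_ne fun hab' => hab.lt.ne (w.injective hab')
  refine hw (Equiv.ext fun a => le_antisymm ?_ hmono.le_apply)
  have hmono' : StrictMono w.symm := fun a b hab =>
    hmono.lt_iff_lt.1 (by simpa using hab)
  simpa using hmono'.le_apply (x := w a)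

/-- A criterion for the strong hull property: each generator reverses pairs of total weight `k`, for
every other element some generator reverses only pairs that it reverses too, and the inequality
holds for the sets of elements that extend the common order of two or three given elements. -/
theorem hasStrongHullProperty_mulCayley {M : Type*} [Group M] {S : Set M}
    (φ : M →* Equiv.Perm α) (wt : α × α → ℕ) {k : ℕ} (hwt : ∀ p, 0 < wt p) (hk : 0 < k)
    (hinv : ∀ (g : M) (p : α × α), wt (φ g p.1, φ g p.2) = wt p)
    (hS : ∀ s ∈ S, ∑ p ∈ reversedPairs (φ s), wt p = k)
    (hstep : ∀ g : M, g ≠ 1 → ∃ s ∈ S, reversedPairs (φ s) ⊆ reversedPairs (φ g))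
    (hcount : ∀ u v w : M,
      {x : M | ∀ p, p ∈ orderedPairs (φ u) → p ∈ orderedPairs (φ v) → p ∈ orderedPairs (φ w) →
        p ∈ orderedPairs (φ x)}.encard ≤
      {x : M | ∀ p, p ∈ orderedPairs (φ u) → p ∈ orderedPairs (φ v) →
        p ∈ orderedPairs (φ x)}.encard *
      {x : M | ∀ p, p ∈ orderedPairs (φ v) → p ∈ orderedPairs (φ w) →
        p ∈ orderedPairs (φ x)}.encard) :
    HasStrongHullProperty (SimpleGraph.mulCayley S) := by
  have hdiff : ∀ u v : M, ∑ p ∈ orderedPairs (φ u) ∆ orderedPairs (φ v), wt p =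
      ∑ p ∈ reversedPairs (φ (u⁻¹ * v)), wt p := by
    intro u v
    rw [orderedPairs_symmDiff, Finset.sum_map, map_mul, map_inv]
    exact Finset.sum_congr rfl fun p _ => hinv u p
  have hne : ∀ s ∈ S, s ≠ 1 := by
    rintro s hs rfl
    have := hS 1 hs
    rw [map_one, Finset.sum_eq_zero] at this
    · exact hk.ne this
    · intro p hp
      simp [mem_reversedPairs] at hp
  obtain ⟨hconn, hdist⟩ := connected_and_mul_dist_eq (G := SimpleGraph.mulCayley S)
    (H := fun x => orderedPairs (φ x)) (wt := wt) hk
    (by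
      intro u v huv
      obtain ⟨-, s, hs, rfl | rfl⟩ := (SimpleGraph.mulCayley_adj' S u v).1 huv
      · rw [hdiff, inv_mul_cancel_left, hS s hs]
      · rw [symmDiff_comm, hdiff, inv_mul_cancel_left, hS s hs])
    (by
      intro u v huv
      obtain ⟨s, hs, hsub⟩ := hstep (u⁻¹ * v) fun h => huv (inv_mul_eq_one.1 h)
      refine ⟨u * s, (SimpleGraph.mulCayley_adj' S _ _).2
        ⟨fun h => hne s hs (by simpa using h.symm), s, hs, .inl rfl⟩, ?_⟩
      have hle : orderedPairs (φ u) ∆ orderedPairs (φ (u * s)) ⊆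
          orderedPairs (φ u) ∆ orderedPairs (φ v) := by
        rw [orderedPairs_symmDiff, orderedPairs_symmDiff, ← map_inv, ← map_mul, ← map_mul,
          inv_mul_cancel_left]
        exact Finset.map_subset_map.2 hsub
      have heq : orderedPairs (φ (u * s)) ∆ orderedPairs (φ v) =
          (orderedPairs (φ u) ∆ orderedPairs (φ v)) \
            (orderedPairs (φ u) ∆ orderedPairs (φ (u * s))) := by
        rw [← symmDiff_of_le hle, symmDiff_symmDiff_symmDiff_comm, symmDiff_self, bot_symmDiff]
      have hsum := Finset.sum_sdiff (f := wt) hle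
      rw [hdiff u (u * s), inv_mul_cancel_left, hS s hs] at hsum
      rw [heq, hsum])
  refine ⟨hconn, fun u v w => ?_⟩
  have hopp : ∀ (x y : M) (p : α × α), p ∈ orderedPairs (φ x) → p ∉ orderedPairs (φ y) →
      p.swap ∈ orderedPairs (φ y) ∧ p.swap ∉ orderedPairs (φ x) := by
    rintro x y ⟨a, b⟩ hx hy
    rw [mem_orderedPairs] at hx hy
    rw [mem_orderedPairs, mem_orderedPairs]
    refine ⟨(not_lt.1 hy).lt_of_ne fun h => ?_, hx.asymm⟩
    obtain rfl : b = a := (φ y)⁻¹.injective h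
    exact hx.ne rfl
  have hpair := fun u v => Set.encard_le_encard (halfSpaces_subset_graphHull_pair hk hdist hopp u v)
  refine le_trans (Set.encard_le_encard ?_) ((hcount u v w).trans
    (mul_le_mul' (hpair u v) (hpair v w)))
  intro x hx p hu hv hw
  refine graphHull_subset_halfSpaces hwt hdist _ hx p ?_
  rintro y (rfl | rfl | rfl)
  exacts [hu, hv, hw]

end Cayley

/-! ### Counting linear extensions by words -/

section Words

variable {α : Type*}

/-- The order on which the one-line notations of `u` and `v` agree. -/
def commonOrder [LT α] (u v : Equiv.Perm α) (a b : α) : Prop :=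
  u⁻¹ a < u⁻¹ b ∧ v⁻¹ a < v⁻¹ b

instance [Preorder α] (u v : Equiv.Perm α) : IsStrictOrder α (commonOrder u v) where
  irrefl _ h := lt_irrefl _ h.1
  trans _ _ _ h h' := ⟨h.1.trans h'.1, h.2.trans h'.2⟩

/-- The one-line notation of a bijection turns linear extensions into words. -/
theorem encard_setOf_equiv_eq {N : ℕ} [Fintype α] (hN : Fintype.card α = N) {r : α → α → Prop}
    (hr : ∀ a, ¬ r a a) :
    {e : Fin N ≃ α | ∀ a b, r a b → e.symm a < e.symm b}.encard =
      (linearExtensionWords r).encard := by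
  have hinj : Function.Injective fun e : Fin N ≃ α => List.ofFn e := fun e e' h =>
    DFunLike.coe_injective (List.ofFn_injective h)
  rw [← hinj.encard_image]
  congr 1
  have hcompat : ∀ e : Fin N ≃ α,
      IsCompatible r (List.ofFn e) ↔ ∀ a b, r a b → e.symm a < e.symm b := by
    intro e
    rw [IsCompatible, List.pairwise_ofFn]
    constructor
    · intro h a b hab
      by_contra hlt
      rcases (not_lt.1 hlt).eq_or_lt with heq | hlt
      · obtain rfl := e.symm.injective heq
        exact hr _ hab
      · exact h hlt (by simpa using hab)
    · intro h i j hij hji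
      exact hij.asymm (by simpa using h _ _ hji)
  ext l
  constructor
  · rintro ⟨e, he, rfl⟩
    refine ⟨⟨List.nodup_ofFn.2 e.injective, fun a => ?_⟩, (hcompat e).2 he⟩
    exact (List.mem_ofFn' _ _).2 (e.surjective a)
  · rintro ⟨⟨hnd, hmem⟩, hl⟩
    classical
    let e := hnd.getEquivOfForallMemList l hmem
    obtain rfl : l.length = N := by rw [← hN, ← Fintype.card_fin l.length, Fintype.card_congr e]
    have he : List.ofFn e = l := List.ofFn_get l
    refine ⟨e, (hcompat e).1 ?_, he⟩
    rwa [he]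

end Words

/-! ### The symmetric group -/

theorem hasStrongHullProperty_symm (n : ℕ) :
    HasStrongHullProperty (SimpleGraph.mulCayley (symmSimple n)) := by
  have hrev : ∀ i j : Fin n, (j : ℕ) = i + 1 →
      reversedPairs (Equiv.swap i j) = {(i, j), (j, i)} := by
    intro i j hij
    have hval : ∀ p, ((Equiv.swap i j p : Fin n) : ℕ) =
        if (p : ℕ) = i then (j : ℕ) else if (p : ℕ) = j then (i : ℕ) else p := by
      intro p
      simp only [Equiv.swap_apply_def, Fin.ext_iff]
      split_ifs <;> rfl
    ext ⟨p, q⟩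
    rw [mem_reversedPairs, Equiv.swap_inv]
    simp only [Finset.mem_insert, Finset.mem_singleton, Prod.mk.injEq, Fin.ext_iff, Fin.lt_def,
      hval]
    split_ifs <;> omega
  refine hasStrongHullProperty_mulCayley (MonoidHom.id _) (fun _ => 1) (k := 2)
    (fun _ => one_pos) two_pos (fun _ _ => rfl) ?_ ?_ ?_
  · rintro s ⟨i, j, hij, rfl⟩
    rw [MonoidHom.id_apply, hrev i j hij, Finset.sum_const, Finset.card_pair, smul_eq_mul]
    intro h
    have := congrArg (fun p : Fin n × Fin n => (p.1 : ℕ)) h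
    simp only at this
    omega
  · intro g hg
    obtain ⟨i, j, hij, hgij⟩ := exists_covBy_apply_lt (inv_ne_one.2 hg)
    have hij' : (j : ℕ) = i + 1 := by
      have := Fin.covBy_iff.1 hij
      rw [Nat.covBy_iff_add_one_eq] at this
      exact this.symm
    refine ⟨_, ⟨i, j, hij', rfl⟩, ?_⟩
    rw [MonoidHom.id_apply, MonoidHom.id_apply, hrev i j hij']
    intro p hp
    rw [mem_reversedPairs]
    rcases Finset.mem_insert.1 hp with rfl | hp
    · exact fun h => hgij.asymm (h.2 hij.lt)
    · rw [Finset.mem_singleton.1 hp]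
      exact fun h => hij.lt.asymm (h.1 hgij)
  · intro u v w
    have hcount := fun (r : Fin n → Fin n → Prop) (hr : ∀ a, ¬ r a a) =>
      encard_setOf_equiv_eq (N := n) (Fintype.card_fin n) hr
    have key := encard_linearExtensionWords_le (p := commonOrder u v) (q := commonOrder v w)
      (r := fun a b => u⁻¹ a < u⁻¹ b ∧ v⁻¹ a < v⁻¹ b ∧ w⁻¹ a < w⁻¹ b) (by
        rintro x y (h | h) (h' | h')
        · exact .inl ⟨h.1, h.2, h'.2⟩
        · exact absurd h.2 h'.1.asymm
        · exact absurd h.2 h'.1.asymm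
        · exact .inr ⟨h.1, h.2, h'.2⟩)
    rw [← hcount (commonOrder u v) fun a h => irrefl a h,
      ← hcount (commonOrder v w) fun a h => irrefl a h,
      ← hcount (fun a b => u⁻¹ a < u⁻¹ b ∧ v⁻¹ a < v⁻¹ b ∧ w⁻¹ a < w⁻¹ b)
        fun a h => lt_irrefl _ h.1] at key
    simpa only [mem_orderedPairs, commonOrder, MonoidHom.id_apply, Prod.forall, and_imp,
      Equiv.Perm.inv_def] using key

/-! ### The hyperoctahedral group -/

section Hyperoctahedral

variable {n : ℕ}

instance : Finite (SignedIndex n) :=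
  Set.Finite.to_subtype ((Set.finite_Icc (-(n : ℤ)) n).subset fun _ hk => abs_le.1 hk.2)

noncomputable instance : Fintype (SignedIndex n) := Fintype.ofFinite _

theorem SignedIndex.val_neg (k : SignedIndex n) : (-k).1 = -k.1 := rfl

theorem SignedIndex.neg_lt_neg {a b : SignedIndex n} (h : a < b) : -b < -a :=
  Int.neg_lt_neg h

/-- The negative letters `-n, …, -1`, enumerated in increasing order. -/
def SignedIndex.negative (i : Fin n) : SignedIndex n :=
  ⟨(i : ℤ) - n, by omega, by rw [abs_le]; omega⟩

theorem SignedIndex.eq_negative_or (k : SignedIndex n) :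
    ∃ i, k = negative i ∨ k = -negative i := by
  obtain ⟨k, hk, hkn⟩ := k
  rw [abs_le] at hkn
  rcases lt_or_gt_of_ne hk with h | h
  · refine ⟨⟨(k + n).toNat, by omega⟩, .inl (Subtype.ext ?_)⟩
    change k = ((k + n).toNat : ℤ) - n
    omega
  · refine ⟨⟨(n - k).toNat, by omega⟩, .inr (Subtype.ext ?_)⟩
    change k = -(((n - k).toNat : ℤ) - n)
    omega

theorem SignedIndex.negative_lt_neg_negative (i j : Fin n) : negative i < -negative j := by
  change (i : ℤ) - n < -((j : ℤ) - n)
  omega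

theorem SignedIndex.negative_lt_negative {i j : Fin n} : negative i < negative j ↔ i < j := by
  change (i : ℤ) - n < (j : ℤ) - n ↔ _
  rw [Fin.lt_def]
  omega

theorem SignedIndex.negative_injective : Function.Injective (negative (n := n)) := by
  intro i j h
  have h : (i : ℤ) - n = (j : ℤ) - n := congrArg Subtype.val h
  exact Fin.ext (by omega)

/-- The left half `w(-n) … w(-1)` of the one-line notation. -/
def signedWord (w : hyperoctahedral n) : List (SignedIndex n) :=
  List.ofFn fun i => w.1 (SignedIndex.negative i)

theorem signedWord_injective : Function.Injective (signedWord (n := n)) := by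
  intro w w' h
  have h : ∀ i, w.1 (SignedIndex.negative i) = w'.1 (SignedIndex.negative i) :=
    congrFun (List.ofFn_injective h)
  refine Subtype.ext (Equiv.ext fun k => ?_)
  obtain ⟨i, rfl | rfl⟩ := k.eq_negative_or
  · exact h i
  · rw [w.2, w'.2, h]

theorem signedWord_nodup (w : hyperoctahedral n) :
    (signedWord w ++ mirror Neg.neg (signedWord w)).Nodup ∧
      ∀ a, a ∈ signedWord w ++ mirror Neg.neg (signedWord w) := by
  have hinj : Function.Injective fun i => w.1 (SignedIndex.negative i) :=
    w.1.injective.comp SignedIndex.negative_injective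
  have hmem : ∀ a, a ∈ signedWord w ↔ ∃ i, w.1 (SignedIndex.negative i) = a := fun a =>
    List.mem_ofFn' _ _
  refine ⟨List.nodup_append'.2 ⟨List.nodup_ofFn.2 hinj, ?_, ?_⟩, fun a => ?_⟩
  · rw [mirror, List.nodup_reverse]
    exact (List.nodup_ofFn.2 hinj).map (Function.LeftInverse.injective SignedIndex.neg_neg)
  · intro a ha ha'
    rw [mem_mirror SignedIndex.neg_neg, hmem] at ha'
    obtain ⟨i, rfl⟩ := (hmem a).1 ha
    obtain ⟨j, hj⟩ := ha'
    rw [← w.2] at hj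
    exact (SignedIndex.negative_lt_neg_negative j i).ne (w.1.injective hj)
  · rw [List.mem_append, mem_mirror SignedIndex.neg_neg, hmem, hmem]
    obtain ⟨k, rfl⟩ := w.1.surjective a
    obtain ⟨i, rfl | rfl⟩ := k.eq_negative_or
    · exact .inl ⟨i, rfl⟩
    · exact .inr ⟨i, by rw [w.2, SignedIndex.neg_neg]⟩

theorem exists_signedWord_eq {l : List (SignedIndex n)}
    (hl : (l ++ mirror Neg.neg l).Nodup ∧ ∀ a, a ∈ l ++ mirror Neg.neg l) :
    ∃ w : hyperoctahedral n, signedWord w = l := by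
  have hlen : l.length = n := by
    have h1 := signedWord_nodup (1 : hyperoctahedral n)
    have h2 := ((List.perm_ext_iff_of_nodup hl.1 h1.1).2
      fun a => iff_of_true (hl.2 a) (h1.2 a)).length_eq
    simp only [mirror, signedWord, List.length_append, List.length_reverse, List.length_map,
      List.length_ofFn] at h2
    omega
  obtain ⟨g, rfl⟩ : ∃ g : Fin n → SignedIndex n, l = List.ofFn g := by
    have key : ∀ {β : Type} {m : ℕ} (l : List β), l.length = m →
        ∃ g : Fin m → β, l = List.ofFn g := by
      rintro β _ l rfl
      exact ⟨l.get, (List.ofFn_get l).symm⟩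
    exact key l hlen
  obtain ⟨hnd, -, hdisj⟩ := List.nodup_append'.1 hl.1
  have hg : Function.Injective g := List.nodup_ofFn.1 hnd
  have hgneg : ∀ i j, g i ≠ -g j := by
    intro i j h
    refine hdisj ((List.mem_ofFn' _ _).2 ⟨i, rfl⟩) ((mem_mirror SignedIndex.neg_neg).2
      ((List.mem_ofFn' _ _).2 ⟨j, ?_⟩))
    rw [h, SignedIndex.neg_neg]
  -- Extend `g` to all letters by oddness.
  obtain ⟨f, hf, hf'⟩ : ∃ f : SignedIndex n → SignedIndex n,
      (∀ i, f (SignedIndex.negative i) = g i) ∧ ∀ i, f (-SignedIndex.negative i) = -g i := by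
    refine ⟨fun k => if h : k.1 < 0 then g ⟨(k.1 + n).toNat, ?_⟩
      else -g ⟨(n - k.1).toNat, ?_⟩, fun i => ?_, fun i => ?_⟩
    · have := abs_le.1 k.2.2
      omega
    · have := k.2.1
      have := abs_le.1 k.2.2
      omega
    · have h : (SignedIndex.negative i).1 = (i : ℤ) - n := rfl
      have hlt : (SignedIndex.negative i).1 < 0 := by omega
      beta_reduce
      rw [dif_pos hlt]
      congr 1
      exact Fin.ext (by simp only [h]; omega)
    · have h : (-SignedIndex.negative i).1 = -((i : ℤ) - n) := rfl
      have hlt : ¬ (-SignedIndex.negative i).1 < 0 := by omega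
      beta_reduce
      rw [dif_neg hlt]
      refine congrArg (fun j => -g j) (Fin.ext ?_)
      simp only [h]
      omega
  have hneg : Function.Injective (Neg.neg : SignedIndex n → SignedIndex n) :=
    Function.LeftInverse.injective SignedIndex.neg_neg
  have hinj : Function.Injective f := by
    intro k k' h
    obtain ⟨i, rfl | rfl⟩ := k.eq_negative_or <;> obtain ⟨j, rfl | rfl⟩ := k'.eq_negative_or <;>
      simp only [hf, hf'] at h
    · rw [hg h]
    · exact absurd h (hgneg i j)
    · exact absurd h.symm (hgneg j i)
    · rw [hg (hneg h)]
  refine ⟨⟨Equiv.ofBijective f (Finite.injective_iff_bijective.1 hinj), fun k => ?_⟩,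
    congrArg List.ofFn (funext hf)⟩
  simp only [Equiv.ofBijective_apply]
  obtain ⟨i, rfl | rfl⟩ := k.eq_negative_or
  · rw [hf, hf']
  · rw [SignedIndex.neg_neg, hf, hf', SignedIndex.neg_neg]

/-- Compatibility of the left half of the one-line notation says that the whole notation extends
`r`. -/
theorem isSignedCompatible_signedWord {r : SignedIndex n → SignedIndex n → Prop}
    (hr : ∀ a, ¬ r a a) (hneg : ∀ a b, r a b → r (-b) (-a)) (w : hyperoctahedral n) :
    IsSignedCompatible Neg.neg r (signedWord w) ↔ ∀ a b, r a b → w.1⁻¹ a < w.1⁻¹ b := by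
  have hmem : ∀ a, a ∈ signedWord w ↔ ∃ i, w.1 (SignedIndex.negative i) = a := fun a =>
    List.mem_ofFn' _ _
  have hinv : ∀ k, w.1⁻¹ (w.1 k) = k := w.1.symm_apply_apply
  rw [IsSignedCompatible, signedWord, IsCompatible, List.pairwise_ofFn, ← signedWord]
  constructor
  · rintro ⟨h1, h2⟩ a b hab
    have h2 : ∀ i j, ¬ r (w.1 (-SignedIndex.negative i)) (w.1 (SignedIndex.negative j)) := by
      intro i j
      rw [w.2]
      exact h2 _ ((hmem _).2 ⟨j, rfl⟩) _ ((hmem _).2 ⟨i, rfl⟩)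
    have h1 : ∀ i j, r (w.1 (SignedIndex.negative i)) (w.1 (SignedIndex.negative j)) → i < j := by
      intro i j hij
      by_contra hlt
      rcases (not_lt.1 hlt).eq_or_lt with rfl | hlt
      · exact hr _ hij
      · exact h1 hlt hij
    obtain ⟨k, rfl⟩ := w.1.surjective a
    obtain ⟨k', rfl⟩ := w.1.surjective b
    rw [hinv, hinv]
    obtain ⟨i, rfl | rfl⟩ := k.eq_negative_or <;> obtain ⟨j, rfl | rfl⟩ := k'.eq_negative_or
    · exact SignedIndex.negative_lt_negative.2 (h1 i j hab)
    · exact SignedIndex.negative_lt_neg_negative i j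
    · exact absurd hab (h2 i j)
    · refine SignedIndex.neg_lt_neg (SignedIndex.negative_lt_negative.2 (h1 j i ?_))
      have := hneg _ _ hab
      rwa [w.2, w.2, SignedIndex.neg_neg, SignedIndex.neg_neg] at this
  · intro h
    refine ⟨fun i j hij hji => ?_, fun a ha b hb hba => ?_⟩
    · have := h _ _ hji
      rw [hinv, hinv] at this
      exact this.asymm (SignedIndex.negative_lt_negative.2 hij)
    · obtain ⟨i, rfl⟩ := (hmem a).1 ha
      obtain ⟨j, rfl⟩ := (hmem b).1 hb
      have := h _ _ hba
      rw [← w.2, hinv, hinv] at this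
      exact this.asymm (SignedIndex.negative_lt_neg_negative i j)

theorem encard_setOf_hyperoctahedral_eq {r : SignedIndex n → SignedIndex n → Prop}
    (hr : ∀ a, ¬ r a a) (hneg : ∀ a b, r a b → r (-b) (-a)) :
    {w : hyperoctahedral n | ∀ a b, r a b → w.1⁻¹ a < w.1⁻¹ b}.encard =
      (signedExtensionWords Neg.neg r).encard := by
  rw [← signedWord_injective.encard_image]
  congr 1
  ext l
  constructor
  · rintro ⟨w, hw, rfl⟩
    exact ⟨signedWord_nodup w, (isSignedCompatible_signedWord hr hneg w).2 hw⟩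
  · rintro ⟨hl, hc⟩
    obtain ⟨w, rfl⟩ := exists_signedWord_eq hl
    exact ⟨w, (isSignedCompatible_signedWord hr hneg w).1 hc, rfl⟩

theorem SignedIndex.covBy_iff {i j : SignedIndex n} :
    i ⋖ j ↔ j.1 = i.1 + 1 ∨ (i.1 = -1 ∧ j.1 = 1) := by
  obtain ⟨i, hi, hin⟩ := i
  obtain ⟨j, hj, hjn⟩ := j
  simp only [abs_le] at hin hjn
  constructor
  · rintro ⟨hlt, hbet⟩
    have hlt : i < j := hlt
    have hbet : ∀ k : ℤ, k ≠ 0 → |k| ≤ n → i < k → ¬ k < j := fun k h h' =>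
      hbet (c := ⟨k, h, h'⟩)
    by_contra! h
    by_cases h1 : i = -1
    · exact hbet 1 one_ne_zero (by rw [abs_le]; omega) (by omega) (by simp only at h; omega)
    · exact hbet (i + 1) (by omega) (by rw [abs_le]; omega) (by omega) (by simp only at h; omega)
  · intro h
    refine ⟨?_, ?_⟩
    · change i < j
      simp only at h
      omega
    · rintro ⟨k, hk, _⟩ h1 h2
      have h1 : i < k := h1
      have h2 : k < j := h2
      simp only at h
      omega

theorem signedSwapPerm_inv_val (i j k : SignedIndex n) :
    (k.1 = i.1 ∧ ((signedSwapPerm i j)⁻¹ k).1 = j.1) ∨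
    (k.1 = j.1 ∧ ((signedSwapPerm i j)⁻¹ k).1 = i.1) ∨
    (k.1 = -i.1 ∧ ((signedSwapPerm i j)⁻¹ k).1 = -j.1) ∨
    (k.1 = -j.1 ∧ ((signedSwapPerm i j)⁻¹ k).1 = -i.1) ∨
    (k.1 ≠ i.1 ∧ k.1 ≠ j.1 ∧ k.1 ≠ -i.1 ∧ k.1 ≠ -j.1 ∧ ((signedSwapPerm i j)⁻¹ k).1 = k.1) := by
  have hi := i.2.1
  have hj := j.2.1
  have hswap : ∀ a b c : SignedIndex n, (Equiv.swap a b c).1 =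
      if c.1 = a.1 then b.1 else if c.1 = b.1 then a.1 else c.1 := by
    intro a b c
    simp only [Equiv.swap_apply_def, Subtype.ext_iff]
    split_ifs <;> rfl
  unfold signedSwapPerm
  by_cases h : j = -i
  · rw [if_pos h, Equiv.swap_inv, hswap]
    have h : j.1 = -i.1 := congrArg Subtype.val h
    split_ifs <;> omega
  · rw [if_neg h, mul_inv_rev, Equiv.swap_inv, Equiv.swap_inv, Equiv.Perm.mul_apply, hswap, hswap]
    have h : j.1 ≠ -i.1 := fun h' => h (Subtype.ext h')
    simp only [SignedIndex.val_neg]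
    split_ifs <;> omega

theorem signedSwap_neg_comm (i : SignedIndex n) : signedSwap i (-i) = signedSwap (-i) i := by
  refine Subtype.ext ?_
  simp only [signedSwap, signedSwapPerm, SignedIndex.neg_neg, if_true]
  exact Equiv.swap_comm _ _

theorem mem_reversedPairs_signedSwap {i j : SignedIndex n} (hij : i ⋖ j) (p q : SignedIndex n) :
    (p, q) ∈ reversedPairs (signedSwapPerm i j) ↔
      (p = i ∧ q = j) ∨ (p = j ∧ q = i) ∨ (p = -i ∧ q = -j) ∨ (p = -j ∧ q = -i) := by
  have hi := i.2.1
  have hj := j.2.1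
  have hp := p.2.1
  have hq := q.2.1
  have h1 := signedSwapPerm_inv_val i j p
  have h2 := signedSwapPerm_inv_val i j q
  rw [SignedIndex.covBy_iff] at hij
  rw [mem_reversedPairs]
  simp only [Subtype.ext_iff, SignedIndex.val_neg, ← Subtype.coe_lt_coe]
  generalize ((signedSwapPerm i j)⁻¹ p).1 = p' at *
  generalize ((signedSwapPerm i j)⁻¹ q).1 = q' at *
  generalize i.1 = i at *
  generalize j.1 = j at *
  generalize p.1 = p at *
  generalize q.1 = q at *
  rcases h1 with h1 | h1 | h1 | h1 | h1 <;> rcases h2 with h2 | h2 | h2 | h2 | h2 <;> omega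

/-- The reflections `t_{i,j}` and `t_{i,-i}` reverse four and two pairs of letters; the weight
`2` on pairs of opposite letters makes up for the difference. -/
noncomputable def signedPairWeight (p : SignedIndex n × SignedIndex n) : ℕ :=
  if p.2 = -p.1 then 2 else 1

theorem sum_reversedPairs_signedSwap {i j : SignedIndex n} (hij : i ⋖ j) :
    ∑ p ∈ reversedPairs (signedSwapPerm i j), signedPairWeight p = 4 := by
  have hij' := hij
  rw [SignedIndex.covBy_iff] at hij'
  have hi := i.2.1
  have hj := j.2.1
  by_cases h : j = -i
  · subst h
    have hset : reversedPairs (signedSwapPerm i (-i)) = {(i, -i), (-i, i)} := by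
      ext ⟨p, q⟩
      rw [mem_reversedPairs_signedSwap hij, SignedIndex.neg_neg]
      simp only [Finset.mem_insert, Finset.mem_singleton, Prod.mk.injEq]
      tauto
    rw [hset, Finset.sum_pair]
    · simp [signedPairWeight, SignedIndex.neg_neg]
    · simp only [ne_eq, Prod.mk.injEq, Subtype.ext_iff, SignedIndex.val_neg]
      omega
  · have h' : j.1 ≠ -i.1 := fun h' => h (Subtype.ext h')
    have hset : reversedPairs (signedSwapPerm i j) = {(i, j), (j, i), (-i, -j), (-j, -i)} := by
      ext ⟨p, q⟩
      rw [mem_reversedPairs_signedSwap hij]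
      simp only [Finset.mem_insert, Finset.mem_singleton, Prod.mk.injEq]
    rw [hset, Finset.sum_insert, Finset.sum_insert, Finset.sum_pair]
    · simp only [signedPairWeight, Subtype.ext_iff, SignedIndex.val_neg]
      repeat rw [if_neg (by omega)]
      rfl
    all_goals
      simp only [ne_eq, Finset.mem_insert, Finset.mem_singleton, Prod.mk.injEq, Subtype.ext_iff,
        SignedIndex.val_neg]
      omega

/-- A descent of `g⁻¹` at a pair of adjacent letters gives, after a change of sign if both letters
are negative, a simple reflection reversing only pairs that `g` reverses. -/
theorem exists_simple_reversedPairs_subset {g : hyperoctahedral n} (hg : g ≠ 1) :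
    ∃ s ∈ hyperoctahedralSimple n, reversedPairs s.1 ⊆ reversedPairs g.1 := by
  obtain ⟨i, j, hij, hgij⟩ := exists_covBy_apply_lt (w := g.1⁻¹)
    (fun h => hg (Subtype.ext (inv_eq_one.1 h)))
  have hneg : ∀ k, g.1⁻¹ (-k) = -g.1⁻¹ k := (g⁻¹).2
  have hsub : ∀ i j : SignedIndex n, i ⋖ j → g.1⁻¹ j < g.1⁻¹ i →
      reversedPairs (signedSwap i j).1 ⊆ reversedPairs g.1 := by
    rintro i j hij hgij ⟨p, q⟩ hpq
    have hlt := hij.lt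
    have hlt' := SignedIndex.neg_lt_neg hlt
    have hgij' := SignedIndex.neg_lt_neg hgij
    rw [← hneg, ← hneg] at hgij'
    rw [mem_reversedPairs]
    rcases (mem_reversedPairs_signedSwap hij p q).1 hpq with
      ⟨rfl, rfl⟩ | ⟨rfl, rfl⟩ | ⟨rfl, rfl⟩ | ⟨rfl, rfl⟩
    · exact fun h => hgij.asymm (h.2 hlt)
    · exact fun h => hlt.asymm (h.1 hgij)
    · exact fun h => hlt'.asymm (h.1 hgij')
    · exact fun h => hgij'.asymm (h.2 hlt')
  have hi := i.2.1
  have hj := j.2.1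
  rcases SignedIndex.covBy_iff.1 hij with h | ⟨h1, h2⟩
  · rcases lt_or_gt_of_ne hi with h0 | h0
    · refine ⟨signedSwap (-j) (-i), .inl ⟨-j, -i, ?_, ?_, rfl⟩, hsub (-j) (-i) ?_ ?_⟩
      · rw [SignedIndex.val_neg]
        omega
      · rw [SignedIndex.val_neg, SignedIndex.val_neg]
        omega
      · rw [SignedIndex.covBy_iff, SignedIndex.val_neg, SignedIndex.val_neg]
        omega
      · rw [hneg, hneg]
        exact SignedIndex.neg_lt_neg hgij
    · exact ⟨signedSwap i j, .inl ⟨i, j, by omega, h, rfl⟩, hsub i j hij hgij⟩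
  · obtain rfl : i = -j := Subtype.ext (by rw [SignedIndex.val_neg]; omega)
    refine ⟨signedSwap j (-j), .inr ⟨j, h2, rfl⟩, ?_⟩
    rw [signedSwap_neg_comm]
    exact hsub _ _ hij hgij

theorem hasStrongHullProperty_hyperoctahedral (n : ℕ) :
    HasStrongHullProperty (SimpleGraph.mulCayley (hyperoctahedralSimple n)) := by
  refine hasStrongHullProperty_mulCayley (hyperoctahedral n).subtype signedPairWeight (k := 4)
    (fun p => ?_) (by norm_num) (fun g p => ?_) ?_
    (fun g hg => exists_simple_reversedPairs_subset hg) ?_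
  · rw [signedPairWeight]
    split_ifs <;> norm_num
  · have h : g.1 p.2 = -g.1 p.1 ↔ p.2 = -p.1 := by
      rw [← g.2, g.1.injective.eq_iff]
    simp only [signedPairWeight, Subgroup.subtype_apply, h]
  · rintro s (⟨i, j, hi, hij, rfl⟩ | ⟨i, hi, rfl⟩)
    · exact sum_reversedPairs_signedSwap (SignedIndex.covBy_iff.2 (.inl hij))
    · rw [signedSwap_neg_comm]
      refine sum_reversedPairs_signedSwap (SignedIndex.covBy_iff.2 (.inr ⟨?_, hi⟩))
      rw [SignedIndex.val_neg, hi]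
  · intro u v w
    have hlt : ∀ (u : hyperoctahedral n) (a b : SignedIndex n), u.1⁻¹ a < u.1⁻¹ b →
        u.1⁻¹ (-b) < u.1⁻¹ (-a) := by
      intro u a b h
      have hneg : ∀ k, u.1⁻¹ (-k) = -u.1⁻¹ k := (u⁻¹).2
      rw [hneg, hneg]
      exact SignedIndex.neg_lt_neg h
    have hcommon : ∀ (u v : hyperoctahedral n) (a b : SignedIndex n),
        commonOrder u.1 v.1 a b → commonOrder u.1 v.1 (-b) (-a) := fun u v a b h =>
      ⟨hlt u a b h.1, hlt v a b h.2⟩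
    let r : SignedIndex n → SignedIndex n → Prop := fun a b =>
      u.1⁻¹ a < u.1⁻¹ b ∧ v.1⁻¹ a < v.1⁻¹ b ∧ w.1⁻¹ a < w.1⁻¹ b
    have hr : ∀ a b, r a b → r (-b) (-a) := fun a b h =>
      ⟨hlt u a b h.1, hlt v a b h.2.1, hlt w a b h.2.2⟩
    have key := encard_signedExtensionWords_le (p := commonOrder u.1 v.1)
      (q := commonOrder v.1 w.1) (r := r) SignedIndex.neg_neg (hcommon u v) (hcommon v w) (by
        rintro x y (h | h) (h' | h')
        · exact .inl ⟨h.1, h.2, h'.2⟩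
        · exact absurd h.2 h'.1.asymm
        · exact absurd h.2 h'.1.asymm
        · exact .inr ⟨h.1, h.2, h'.2⟩)
    rw [← encard_setOf_hyperoctahedral_eq (fun a h => irrefl a h) (hcommon u v),
      ← encard_setOf_hyperoctahedral_eq (fun a h => irrefl a h) (hcommon v w),
      ← encard_setOf_hyperoctahedral_eq (fun a h => lt_irrefl _ h.1) hr] at key
    simpa only [mem_orderedPairs, commonOrder, r, Subgroup.subtype_apply, Prod.forall,
      and_imp] using key

end Hyperoctahedral

/-! ### Sidorenko's inequality -/

section Sidorenko

variable {α : Type*}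

theorem isStrictOrder_lt_of_partialOrder (P : PartialOrder α) : IsStrictOrder α P.lt where
  irrefl a := @lt_irrefl α P.toPreorder a
  trans _ _ _ := @lt_trans α P.toPreorder _ _ _

theorem numLinearExtensions_eq [Fintype α] (P : PartialOrder α) :
    (numLinearExtensions P : ℕ∞) = (linearExtensionWords P.lt).encard := by
  rw [← encard_setOf_equiv_eq rfl (fun a => @lt_irrefl α P.toPreorder a), numLinearExtensions,
    ← Set.Finite.cast_ncard_eq (Set.toFinite _), ← Nat.card_coe_set_eq]
  refine congrArg _ (Nat.card_congr (Equiv.subtypeEquiv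
    ⟨Equiv.symm, Equiv.symm, fun _ => rfl, fun _ => rfl⟩ fun f => ?_))
  change (∀ x y, P.le x y → f x ≤ f y) ↔ ∀ x y, P.lt x y → f x < f y
  constructor
  · intro h x y hxy
    exact (h x y (@le_of_lt α P.toPreorder _ _ hxy)).lt_of_ne fun hf =>
      @ne_of_lt α P.toPreorder _ _ hxy (f.injective hf)
  · intro h x y hxy
    rcases (@le_iff_lt_or_eq α P x y).1 hxy with hxy | rfl
    · exact (h x y hxy).le
    · exact le_rfl

/-- If `P` is the intersection of two linear orders, then the intersection of the first with the
reverse of the second is a complement of `P`. -/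
theorem IsTwoDimensional.exists_isComplementOrder {P : PartialOrder α} (hP : IsTwoDimensional P) :
    ∃ Q : PartialOrder α, IsComplementOrder P Q := by
  obtain ⟨L₁, L₂, hL⟩ := hP
  refine ⟨{ le := fun x y => L₁.le x y ∧ L₂.le y x
            lt := fun x y => (L₁.le x y ∧ L₂.le y x) ∧ ¬ (L₁.le y x ∧ L₂.le x y)
            lt_iff_le_not_ge := fun _ _ => Iff.rfl
            le_refl := fun x => ⟨L₁.le_refl x, L₂.le_refl x⟩
            le_trans := fun x y z h h' =>
              ⟨L₁.le_trans x y z h.1 h'.1, L₂.le_trans z y x h'.2 h.2⟩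
            le_antisymm := fun x y h h' => L₁.le_antisymm x y h.1 h'.1 }, fun x y hxy => ?_⟩
  rw [hL, hL]
  change ((L₁.le x y ∧ L₂.le y x) ∨ (L₁.le y x ∧ L₂.le x y)) ↔ _
  have h1 := L₁.le_total x y
  have h2 := L₂.le_total x y
  have h3 := fun h h' => hxy (L₁.le_antisymm x y h h')
  have h4 := fun h h' => hxy (L₂.le_antisymm x y h h')
  tauto

/-- No two elements are comparable in both of two complementary orders, so that the linear
extensions of the empty relation, which are all the orderings, inject into the pairs of linear
extensions of the two orders. -/
theorem IsComplementOrder.factorial_le [Fintype α] {P Q : PartialOrder α}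
    (h : IsComplementOrder P Q) :
    (Fintype.card α).factorial ≤ numLinearExtensions P * numLinearExtensions Q := by
  classical
  have := isStrictOrder_lt_of_partialOrder P
  have := isStrictOrder_lt_of_partialOrder Q
  have key := encard_linearExtensionWords_le (p := P.lt) (q := Q.lt) (r := fun _ _ => False) (by
    intro x y hP hQ
    have hle : ∀ (R : PartialOrder α) (x y : α), R.lt x y → R.le x y := fun R x y =>
      @le_of_lt α R.toPreorder x y
    have hne : x ≠ y := by
      rintro rfl
      exact hP.elim (@lt_irrefl α P.toPreorder x) (@lt_irrefl α P.toPreorder x)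
    exact ((h x y hne).1 (hQ.imp (hle Q _ _) (hle Q _ _)) (hP.imp (hle P _ _) (hle P _ _))).elim)
  rw [← encard_setOf_equiv_eq rfl fun _ h => h, ← numLinearExtensions_eq P,
    ← numLinearExtensions_eq Q] at key
  have huniv : {e : Fin (Fintype.card α) ≃ α | ∀ a b, False → e.symm a < e.symm b} = Set.univ :=
    Set.eq_univ_of_forall fun _ _ _ h => h.elim
  rw [huniv, Set.encard_univ, ENat.card_eq_coe_fintype_card,
    Fintype.card_equiv (Fintype.equivFin α).symm, Fintype.card_fin] at key
  exact_mod_cast key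

end Sidorenko

theorem mainTheorem1 :
    (∀ n : ℕ, HasStrongHullProperty (SimpleGraph.mulCayley (symmSimple n))) ∧
    (∀ n : ℕ, HasStrongHullProperty (SimpleGraph.mulCayley (hyperoctahedralSimple n))) ∧
    (∀ (α : Type*) [Fintype α] (P : PartialOrder α), IsTwoDimensional P →
      (∃ Q : PartialOrder α, IsComplementOrder P Q) ∧
      ∀ Q : PartialOrder α, IsComplementOrder P Q →
        (Fintype.card α).factorial ≤ numLinearExtensions P * numLinearExtensions Q) :=
  ⟨hasStrongHullProperty_symm, hasStrongHullProperty_hyperoctahedral,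
    fun _ _ _ hP => ⟨hP.exists_isComplementOrder, fun _ hQ => hQ.factorial_le⟩⟩
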